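/- **Setting.** Let $(\Delta,\mathbb P)$ be a probability space and consider the system $$x_{t+1}=A(\delta_t)x_t+B(\delta_t)u_t+w(\delta_t),\qquad x_0=\bar x_0\in\mathbb R^n,$$ with $A(\cdot)\in\mathbb R^{n\times n}$, $B(\cdot)\in\mathbb R^{n\times m}$, $w(\cdot)\in\mathbb R^n$, a bounded convex set $\mathbb U\subset\mathbb R^m$ of feasible inputs, a convex state constraint set $\mathbb X\subset\mathbb R^n$ and a convex stage cost $\ell:\mathbb R^n\times\mathbb R^m\to[0,\infty)$. Fix a level $\varepsilon\in(0,\tfrac12)$, a horizon $N\ge 1$ and integers $0\le R\le K$. The uncertainties $\delta_t$ and the samples $\delta^{(k)}_{i|t}$ ($t\in\mathbb N$, $1\le k\le K$, $0\le i\le N-1$) are all independent with law $\mathbb P$. Write $\omega_t^{(k)}=(\delta^{(k)}_{0|t},\dots,\delta^{(k)}_{N-1|t})$ and $\omega_t=(\omega_t^{(1)},\dots,\omega_t^{(K)})$. A removal algorithm is a deterministic rule that selects, for every state $x$ and every $\omega\in\Delta^{KN}$, a set $I(x,\omega)$ of $K-R$ of the $K$ scenarios. **Scenario program.** For $x\in\mathbb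 R^n$ and $\omega=(\delta^{(k)}_i)\in\Delta^{KN}$ it reads $$\min_{u_0,\dots,u_{N-1}\in\mathbb U}\ \sum_{k=1}^K\sum_{i=0}^{N-1}\ell\bigl(x_i^{(k)},u_i\bigr)\quad\text{s.t.}\quad x^{(k)}_{i+1}\in\mathbb X\quad\text{for all } k\in I(x,\omega),\ i=0,\dots,N-1,$$ where $x^{(k)}_0=x$ and $x^{(k)}_{i+1}=A(\delta_i^{(k)})x_i^{(k)}+B(\delta_i^{(k)})u_i+w(\delta_i^{(k)})$. Let $u'_0(x,\omega)$ be the first input of an optimal solution (with a fixed choice if there are several optimal solutions, and an arbitrary value if there is none). The closed loop is obtained with $u_t=u'_0(x_t,\omega_t)$. All sets and functions concerned (in particular $A$, $B$, $w$, $\mathbb X$, $u'_0$ and the set of $(x,\omega)$ at which the program is feasible) are assumed measurable. **Resolvability.** Assume that in the closed loop, for every $t$, the scenario program at $(x_t,\omega_t)$ almost surely has a feasible solution. **Admissibility.** Let $V(x,\omega)=\mathbb P\{\delta:\ A(\delta)x+B(\delta)u'_0(x,\omega)+w(\delta)\notin\mathbb X\}$ be the first-step violation probability. The sample-removal pair $(K,R)$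 is *admissible* if $$\mathbb E^{KN}[V\mid x]=\int_{\Delta^{KN}}V(x,\omega)\,d\mathbb P^{KN}(\omega)\le\varepsilon$$ for every state $x$ at which the scenario program is feasible for $\mathbb P^{KN}$-almost every $\omega$. **Theorem.** Under these assumptions, let $(K,R)$ be an admissible sample-removal pair and let $M_t=1$ if $x_{t+1}\notin\mathbb X$ and $M_t=0$ otherwise, along the closed loop. Then $$\limsup_{T\to\infty}\ \frac1T\sum_{t=0}^{T-1}M_t\ \le\ \varepsilon\qquad\text{almost surely.}$$ -/

import Mathlib

open MeasureTheory ProbabilityTheory Filter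

namespace SCMPC

/-- The data of the stochastic control problem: the linear stochastic transition map
`x⁺ = A(δ) x + B(δ) u + w(δ)` driven by the uncertainty `δ ∈ Δ`, the initial condition, the set of
feasible inputs, the state constraint set, and the stage cost. -/
structure ControlProblem (Δ : Type*) (n m : ℕ) where
  A : Δ → Matrix (Fin n) (Fin n) ℝ
  B : Δ → Matrix (Fin n) (Fin m) ℝ
  w : Δ → Fin n → ℝ
  x₀ : Fin n → ℝ
  inputSet : Set (Fin m → ℝ)
  stateSet : Set (Fin n → ℝ)
  stageCost : (Fin n → ℝ) → (Fin m → ℝ) → ℝ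

/-- `N` successive uncertainties: one full-horizon sample. -/
abbrev Scenario (Δ : Type*) (N : ℕ) : Type _ := Fin N → Δ

/-- The `K` scenarios that are drawn at one time step. -/
abbrev Scenarios (Δ : Type*) (K N : ℕ) : Type _ := Fin K → Scenario Δ N

/-- A plan of `N` inputs. -/
abbrev Plan (m N : ℕ) : Type := Fin N → Fin m → ℝ

/-- A scenario removal algorithm: for each state `ξ`, a deterministic function that selects
(through their indices) `K - R` out of `K` scenarios. -/
structure RemovalAlgorithm (Δ : Type*) (n N K R : ℕ) where
  le : R ≤ K
  select : (Fin n → ℝ) → Scenarios Δ K N → Finset (Fin K)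
  card_select : ∀ ξ ω, (select ξ ω).card = K - R

namespace ControlProblem

variable {Δ : Type*} {n m N K R : ℕ}

/-- Standing assumptions on the control problem (convexity, boundedness of the inputs, nonnegative
cost) and measurability of the system matrices, the disturbance and the state constraint set. -/
structure Regular [MeasurableSpace Δ] (C : ControlProblem Δ n m) : Prop where
  measurable_A : ∀ i j, Measurable fun d => C.A d i j
  measurable_B : ∀ i j, Measurable fun d => C.B d i j
  measurable_w : Measurable C.w
  isBounded_inputSet : Bornology.IsBounded C.inputSet
  convex_inputSet : Convex ℝ C.inputSet
  convex_stateSet : Convex ℝ C.stateSet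
  measurableSet_stateSet : MeasurableSet C.stateSet
  stageCost_nonneg : ∀ x u, 0 ≤ C.stageCost x u
  convexOn_stageCost :
    ConvexOn ℝ Set.univ fun p : (Fin n → ℝ) × (Fin m → ℝ) => C.stageCost p.1 p.2

/-- The transition map `A(δ) x + B(δ) u + w(δ)`. -/
def step (C : ControlProblem Δ n m) (d : Δ) (x : Fin n → ℝ) (u : Fin m → ℝ) : Fin n → ℝ :=
  (C.A d).mulVec x + (C.B d).mulVec u + C.w d

/-- The predicted states `x_{0|t} = x, x_{1|t}, …, x_{N|t}` under the scenario `d` and the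
plan `u`. -/
def predicted (C : ControlProblem Δ n m) (x : Fin n → ℝ) (d : Scenario Δ N) (u : Plan m N) :
    Fin (N + 1) → Fin n → ℝ :=
  Fin.induction x fun i y => C.step (d i) y (u i)

/-- The cost of the finite-horizon scenario program, summed over all `K` scenarios. -/
def cost (C : ControlProblem Δ n m) (x : Fin n → ℝ) (ω : Scenarios Δ K N) (u : Plan m N) : ℝ :=
  ∑ k, ∑ i : Fin N, C.stageCost (C.predicted x (ω k) u i.castSucc) (u i)

/-- Feasibility of a plan for the finite-horizon scenario program at state `x` that keeps only the
state constraints of the scenarios selected by the removal algorithm. -/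
def IsFeasible (C : ControlProblem Δ n m) (𝒜 : RemovalAlgorithm Δ n N K R) (x : Fin n → ℝ)
    (ω : Scenarios Δ K N) (u : Plan m N) : Prop :=
  (∀ i, u i ∈ C.inputSet) ∧
    ∀ k ∈ 𝒜.select x ω, ∀ i : Fin N, C.predicted x (ω k) u i.succ ∈ C.stateSet

/-- Optimality of a plan for that program. -/
def IsOptimal (C : ControlProblem Δ n m) (𝒜 : RemovalAlgorithm Δ n N K R) (x : Fin n → ℝ)
    (ω : Scenarios Δ K N) (u : Plan m N) : Prop :=
  C.IsFeasible 𝒜 x ω u ∧ ∀ v, C.IsFeasible 𝒜 x ω v → C.cost x ω u ≤ C.cost x ω v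

/-- `sol` is a scenario solution map: `sol x ω` is an optimal solution of the program at `x` under
the scenarios `ω` whenever there is one (ties are broken arbitrarily), and its first input depends
measurably on state and scenarios. -/
structure IsScenarioSolution [MeasurableSpace Δ] [NeZero N] (C : ControlProblem Δ n m)
    (𝒜 : RemovalAlgorithm Δ n N K R)
    (sol : (Fin n → ℝ) → Scenarios Δ K N → Plan m N) : Prop where
  isOptimal : ∀ x ω, (∃ u, C.IsOptimal 𝒜 x ω u) → C.IsOptimal 𝒜 x ω (sol x ω)
  measurable_first : Measurable fun p : (Fin n → ℝ) × Scenarios Δ K N => sol p.1 p.2 0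

/-- The closed-loop trajectory under the receding-horizon law `u_t = sol x_t ω_t 0`, for given
realisations of the uncertainties `δ_t` and of the scenarios `ω_t`. -/
def closedLoop [NeZero N] (C : ControlProblem Δ n m)
    (sol : (Fin n → ℝ) → Scenarios Δ K N → Plan m N)
    (δ : ℕ → Δ) (ω : ℕ → Scenarios Δ K N) : ℕ → Fin n → ℝ
  | 0 => C.x₀
  | t + 1 => C.step (δ t) (closedLoop C sol δ ω t) (sol (closedLoop C sol δ ω t) (ω t) 0)

/-- `M_t`, the indicator of `x_{t+1} ∉ 𝕏` in the closed loop. -/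
noncomputable def violation [NeZero N] (C : ControlProblem Δ n m)
    (sol : (Fin n → ℝ) → Scenarios Δ K N → Plan m N)
    (δ : ℕ → Δ) (ω : ℕ → Scenarios Δ K N) (t : ℕ) : ℝ :=
  (C.stateSetᶜ).indicator (fun _ => 1) (C.closedLoop sol δ ω (t + 1))

/-- The first-step violation probability at the state `x`, as a function of the scenarios. -/
noncomputable def violationProb [MeasurableSpace Δ] [NeZero N] (C : ControlProblem Δ n m)
    (P : Measure Δ) (sol : (Fin n → ℝ) → Scenarios Δ K N → Plan m N)
    (x : Fin n → ℝ) (ω : Scenarios Δ K N) : ℝ :=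
  P.real {d | C.step d x (sol x ω 0) ∉ C.stateSet}

/-- The law `P^{KN}` of the scenarios that are drawn at one time step. -/
noncomputable def scenarioLaw [MeasurableSpace Δ] (P : Measure Δ) (K N : ℕ) :
    Measure (Scenarios Δ K N) :=
  Measure.pi fun _ => Measure.pi fun _ => P

/-- Admissibility of the sample-removal pair `(K, R)` (with removal algorithm `𝒜`): at each state
where the scenario program is almost surely feasible, the expected first-step violation probability
is at most `ε`. -/
def IsAdmissible [MeasurableSpace Δ] [NeZero N] (C : ControlProblem Δ n m) (P : Measure Δ)
    (𝒜 : RemovalAlgorithm Δ n N K R) (sol : (Fin n → ℝ) → Scenarios Δ K N → Plan m N)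
    (ε : ℝ) : Prop :=
  ∀ x, (∀ᵐ ω ∂scenarioLaw P K N, ∃ u, C.IsFeasible 𝒜 x ω u) →
    ∫ ω, C.violationProb P sol x ω ∂scenarioLaw P K N ≤ ε

/-- Resolvability: in the closed loop, the scenario program is almost surely feasible at every
time step. -/
def IsResolvable [NeZero N] {S : Type*} [MeasurableSpace S] (C : ControlProblem Δ n m)
    (𝒜 : RemovalAlgorithm Δ n N K R) (sol : (Fin n → ℝ) → Scenarios Δ K N → Plan m N)
    (μ : Measure S) (δ : ℕ → S → Δ) (ω : ℕ → S → Scenarios Δ K N) : Prop :=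
  ∀ t, ∀ᵐ s ∂μ, ∃ u, C.IsFeasible 𝒜
    (C.closedLoop sol (fun r => δ r s) (fun r => ω r s) t) (ω t s) u

end ControlProblem

/-- The uncertainties `δ t` together with all the samples `ω t · k i` (time `t`, scenario `k`,
prediction step `i`) form one family of independent random variables with common law `P`. -/
structure IsIID {Δ S : Type*} [MeasurableSpace Δ] [MeasurableSpace S] {K N : ℕ}
    (P : Measure Δ) (μ : Measure S) (δ : ℕ → S → Δ) (ω : ℕ → S → Scenarios Δ K N) : Prop where
  measurable_uncertainty : ∀ t, Measurable (δ t)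
  measurable_sample : ∀ t k i, Measurable fun s => ω t s k i
  map_uncertainty : ∀ t, μ.map (δ t) = P
  map_sample : ∀ t k i, μ.map (fun s => ω t s k i) = P
  indep : iIndepFun
    (Sum.elim δ fun (q : ℕ × Fin K × Fin N) (s : S) => ω q.1 s q.2.1 q.2.2) μ

end SCMPC

/-! The state `x_t` is a function of the draws made before time `t`, and the fresh pair `(δ_t, ω_t)`
is independent of those draws. By Fubini, resolvability makes almost every reached state one at
which the program is almost surely feasible. Admissibility then bounds by `ε` the conditional
probability, given the past, of leaving the constraint set at step `t`. The violations need not be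
independent, but this conditional bound suffices for a Chernoff estimate: each step multiplies the
exponential moment of the violation count by at most `1 + (exp l - 1) * ε`
(`lintegral_exp_eventCount_le`). For `a > ε` and a suitable `l`, the probability that the count
reaches `T * a` therefore decays geometrically in `T`. Borel–Cantelli and a sequence `a ↓ ε` finish
the proof. -/

namespace SCMPC

/-! ### Chernoff bound and Borel–Cantelli for events of conditional probability at most `ε` -/

section ExponentialBound

/-- To first order in `l` the two sides are `1 + l * ε` and `1 + l * a`, so any small `l` works. -/
theorem exists_exp_rate_lt {ε a : ℝ} (h0 : 0 ≤ ε) (h1 : ε ≤ 1) (ha : ε < a) :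
    ∃ l : ℝ, 0 < l ∧ 1 + (Real.exp l - 1) * ε < Real.exp (l * a) := by
  -- The bound by `1` permits the quadratic Taylor estimate of `exp`; the other gives `ε * (1 + l) ≤
  -- ε + l < a`.
  have hl : 0 < min 1 ((a - ε) / 2) := lt_min one_pos (by linarith)
  refine ⟨min 1 ((a - ε) / 2), hl, ?_⟩
  have hl1 : min 1 ((a - ε) / 2) ≤ 1 := min_le_left _ _
  have hl2 : min 1 ((a - ε) / 2) ≤ (a - ε) / 2 := min_le_right _ _
  generalize min 1 ((a - ε) / 2) = l at *
  have hexp : Real.exp l - 1 ≤ l + l ^ 2 := by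
    have h := Real.abs_exp_sub_one_sub_id_le (x := l) (by rw [abs_of_pos hl]; exact hl1)
    linarith [le_abs_self (Real.exp l - 1 - l)]
  have hlin := Real.add_one_le_exp (l * a)
  have hmul : (Real.exp l - 1) * ε ≤ (l + l ^ 2) * ε := mul_le_mul_of_nonneg_right hexp h0
  have hsq : l * (ε * (1 + l)) < l * a := by
    refine mul_lt_mul_of_pos_left ?_ hl
    nlinarith [mul_le_mul_of_nonneg_right h1 hl.le]
  nlinarith

variable {S : Type*}

/-- The number of the events `A 0, …, A (T - 1)` that occur. -/
noncomputable def eventCount (A : ℕ → Set S) (T : ℕ) (s : S) : ℝ :=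
  ∑ t ∈ Finset.range T, (A t).indicator (fun _ => 1) s

theorem measurable_eventCount [MeasurableSpace S] {A : ℕ → Set S} {T : ℕ} (hA : ∀ t < T, MeasurableSet (A t)) :
    Measurable (eventCount A T) :=
  Finset.measurable_sum _ fun t ht =>
    measurable_const.indicator (hA t (Finset.mem_range.1 ht))

theorem ofReal_exp_eventCount_succ (A : ℕ → Set S) (T : ℕ) {l : ℝ} (hl : 0 ≤ l) (s : S) :
    ENNReal.ofReal (Real.exp (l * eventCount A (T + 1) s)) =
      ENNReal.ofReal (Real.exp (l * eventCount A T s)) +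
        ENNReal.ofReal (Real.exp l - 1) *
          (A T).indicator (fun s => ENNReal.ofReal (Real.exp (l * eventCount A T s))) s := by
  have h1 : 0 ≤ Real.exp l - 1 := by linarith [Real.add_one_le_exp l]
  rw [eventCount, Finset.sum_range_succ, ← eventCount]
  by_cases hs : s ∈ A T
  · rw [Set.indicator_of_mem hs, Set.indicator_of_mem hs, ← ENNReal.ofReal_mul h1,
      ← ENNReal.ofReal_add (Real.exp_pos _).le (mul_nonneg h1 (Real.exp_pos _).le),
      mul_add, mul_one, Real.exp_add]
    congr 1
    ring
  · simp [Set.indicator_of_notMem hs]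

variable [MeasurableSpace S]

/-- Hypothesis `h` is the conditional bound given the past, tested only against the weight that the
recursion needs. -/
theorem lintegral_exp_eventCount_le {μ : Measure S} [IsProbabilityMeasure μ] {A : ℕ → Set S}
    (hA : ∀ t, MeasurableSet (A t)) {ε l : ℝ} (hε : 0 ≤ ε) (hl : 0 ≤ l)
    (h : ∀ t, ∫⁻ s in A t, ENNReal.ofReal (Real.exp (l * eventCount A t s)) ∂μ ≤
      ENNReal.ofReal ε * ∫⁻ s, ENNReal.ofReal (Real.exp (l * eventCount A t s)) ∂μ) (T : ℕ) :
    ∫⁻ s, ENNReal.ofReal (Real.exp (l * eventCount A T s)) ∂μ ≤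
      ENNReal.ofReal (1 + (Real.exp l - 1) * ε) ^ T := by
  have h1 : 0 ≤ Real.exp l - 1 := by linarith [Real.add_one_le_exp l]
  have hm : ∀ t, Measurable fun s => ENNReal.ofReal (Real.exp (l * eventCount A t s)) := fun t =>
    ((measurable_eventCount fun r _ => hA r).const_mul l).exp.ennreal_ofReal
  induction T with
  | zero => simp [eventCount]
  | succ T ih =>
    simp_rw [ofReal_exp_eventCount_succ A T hl]
    rw [lintegral_add_left (hm T), lintegral_const_mul _ ((hm T).indicator (hA T)),
      lintegral_indicator (hA T)]
    calc _ ≤ ∫⁻ s, ENNReal.ofReal (Real.exp (l * eventCount A T s)) ∂μ +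
          ENNReal.ofReal (Real.exp l - 1) * (ENNReal.ofReal ε *
            ∫⁻ s, ENNReal.ofReal (Real.exp (l * eventCount A T s)) ∂μ) := by
          gcongr
          exact h T
      _ = ENNReal.ofReal (1 + (Real.exp l - 1) * ε) *
            ∫⁻ s, ENNReal.ofReal (Real.exp (l * eventCount A T s)) ∂μ := by
          rw [ENNReal.ofReal_add zero_le_one (mul_nonneg h1 hε), ENNReal.ofReal_mul h1,
            ENNReal.ofReal_one]
          ring
      _ ≤ _ := by
          rw [pow_succ']
          gcongr

theorem ae_eventually_eventCount_lt {μ : Measure S} [IsProbabilityMeasure μ] {A : ℕ → Set S}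
    (hA : ∀ t, MeasurableSet (A t)) {ε : ℝ} (hε0 : 0 ≤ ε) (hε1 : ε ≤ 1)
    (h : ∀ l, 0 ≤ l → ∀ t, ∫⁻ s in A t, ENNReal.ofReal (Real.exp (l * eventCount A t s)) ∂μ ≤
      ENNReal.ofReal ε * ∫⁻ s, ENNReal.ofReal (Real.exp (l * eventCount A t s)) ∂μ)
    {a : ℝ} (ha : ε < a) :
    ∀ᵐ s ∂μ, ∀ᶠ T : ℕ in atTop, eventCount A T s < T * a := by
  obtain ⟨l, hl, hlt⟩ := exists_exp_rate_lt hε0 hε1 ha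
  have h1 : 0 ≤ Real.exp l - 1 := by linarith [Real.add_one_le_exp l]
  -- Geometric ratio of Markov's inequality applied to the exponential moment; the choice of `l`
  -- makes it less than one.
  set q : ℝ := (1 + (Real.exp l - 1) * ε) / Real.exp (l * a) with hq
  have hq1 : q < 1 := (div_lt_one (Real.exp_pos _)).2 hlt
  have hbound : ∀ T : ℕ, μ {s | T * a ≤ eventCount A T s} ≤ ENNReal.ofReal q ^ T := by
    intro T
    have hsub : {s | T * a ≤ eventCount A T s} ⊆
        {s | ENNReal.ofReal (Real.exp (l * a)) ^ T ≤
          ENNReal.ofReal (Real.exp (l * eventCount A T s))} := by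
      intro s hs
      rw [Set.mem_ofPred_eq, ← ENNReal.ofReal_pow (Real.exp_pos _).le, ← Real.exp_nat_mul]
      refine ENNReal.ofReal_le_ofReal (Real.exp_le_exp.2 ?_)
      have := mul_le_mul_of_nonneg_left hs hl.le
      linarith
    have hpos : ENNReal.ofReal (Real.exp (l * a)) ^ T ≠ 0 :=
      pow_ne_zero _ (ENNReal.ofReal_pos.2 (Real.exp_pos _)).ne'
    have htop : ENNReal.ofReal (Real.exp (l * a)) ^ T ≠ ⊤ :=
      ENNReal.pow_ne_top ENNReal.ofReal_ne_top
    have hmeas : Measurable fun s => ENNReal.ofReal (Real.exp (l * eventCount A T s)) :=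
      ((measurable_eventCount fun r _ => hA r).const_mul l).exp.ennreal_ofReal
    refine (measure_mono hsub).trans
      ((meas_ge_le_lintegral_div hmeas.aemeasurable hpos htop).trans ?_)
    rw [hq, ENNReal.ofReal_div_of_pos (Real.exp_pos _), div_eq_mul_inv (ENNReal.ofReal _), mul_pow,
      ← ENNReal.inv_pow, ← div_eq_mul_inv]
    exact ENNReal.div_le_div_right (lintegral_exp_eventCount_le hA hε0 hl.le (h l hl.le) T) _
  have hsum : ∑' T : ℕ, μ {s | T * a ≤ eventCount A T s} ≠ ⊤ := by
    refine ne_top_of_le_ne_top ?_ (ENNReal.tsum_le_tsum hbound)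
    rw [ENNReal.tsum_geometric]
    exact ENNReal.inv_ne_top.2 (tsub_pos_of_lt (by simpa using hq1)).ne'
  filter_upwards [ae_eventually_notMem hsum] with s hs
  exact hs.mono fun T hT => not_le.1 hT

theorem ae_limsup_eventCount_le {μ : Measure S} [IsProbabilityMeasure μ] {A : ℕ → Set S}
    (hA : ∀ t, MeasurableSet (A t)) {ε : ℝ} (hε0 : 0 ≤ ε) (hε1 : ε ≤ 1)
    (h : ∀ l, 0 ≤ l → ∀ t, ∫⁻ s in A t, ENNReal.ofReal (Real.exp (l * eventCount A t s)) ∂μ ≤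
      ENNReal.ofReal ε * ∫⁻ s, ENNReal.ofReal (Real.exp (l * eventCount A t s)) ∂μ) :
    ∀ᵐ s ∂μ, limsup (fun T : ℕ => (1 / (T : ℝ)) * eventCount A T s) atTop ≤ ε := by
  have hall : ∀ᵐ s ∂μ, ∀ j : ℕ, ∀ᶠ T : ℕ in atTop,
      eventCount A T s < T * (ε + 1 / ((j : ℝ) + 1)) :=
    ae_all_iff.2 fun j => ae_eventually_eventCount_lt hA hε0 hε1 h
      (lt_add_of_pos_right _ Nat.one_div_pos_of_nat)
  filter_upwards [hall] with s hs
  -- A real `limsup` is meaningful only with this side condition, which nonnegativity of the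
  -- averages supplies.
  have hbdd : atTop.IsCoboundedUnder (· ≤ ·) fun T : ℕ => (1 / (T : ℝ)) * eventCount A T s := by
    refine IsCoboundedUnder.of_frequently_ge (a := 0) (Frequently.of_forall fun T => ?_)
    exact mul_nonneg (by positivity) (Finset.sum_nonneg fun t _ =>
      Set.indicator_nonneg (fun _ _ => zero_le_one) s)
  have hle : ∀ j : ℕ, limsup (fun T : ℕ => (1 / (T : ℝ)) * eventCount A T s) atTop ≤
      ε + 1 / ((j : ℝ) + 1) := by
    intro j
    refine limsup_le_of_le hbdd ?_
    filter_upwards [hs j, eventually_gt_atTop 0] with T hT hT0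
    have hT0' : (0 : ℝ) < T := Nat.cast_pos.2 hT0
    rw [one_div_mul_eq_div, div_le_iff₀ hT0', mul_comm]
    exact hT.le
  have hlim : Tendsto (fun j : ℕ => ε + 1 / ((j : ℝ) + 1)) atTop (nhds ε) := by
    simpa using (tendsto_one_div_add_atTop_nhds_zero_nat (𝕜 := ℝ)).const_add ε
  exact ge_of_tendsto' hlim hle

end ExponentialBound

/-! ### Conditioning on an independent variable by Fubini -/

section Independence

variable {S α β : Type*} [MeasurableSpace S] [MeasurableSpace α] [MeasurableSpace β]

/-- Conditional bound on an event `(Y, Z) ∈ B` given `Y`, in integrated form. -/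
theorem setLIntegral_comp_le_of_indepFun {μ : Measure S} [IsProbabilityMeasure μ]
    {Y : S → α} {Z : S → β} (hY : Measurable Y) (hZ : Measurable Z) (hYZ : IndepFun Y Z μ)
    {B : Set (α × β)} (hB : MeasurableSet B) {c : ENNReal}
    (hc : ∀ᵐ y ∂μ.map Y, μ.map Z {z | (y, z) ∈ B} ≤ c)
    {F : α → ENNReal} (hF : Measurable F) :
    ∫⁻ s in {s | (Y s, Z s) ∈ B}, F (Y s) ∂μ ≤ c * ∫⁻ s, F (Y s) ∂μ := by
  have := Measure.isProbabilityMeasure_map (μ := μ) hZ.aemeasurable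
  have hG : Measurable (B.indicator fun p => F p.1) := (hF.comp measurable_fst).indicator hB
  calc ∫⁻ s in {s | (Y s, Z s) ∈ B}, F (Y s) ∂μ
      = ∫⁻ s, B.indicator (fun p => F p.1) (Y s, Z s) ∂μ := by
        rw [← lintegral_indicator (show MeasurableSet {s | (Y s, Z s) ∈ B} from hY.prodMk hZ hB)]
        rfl
    _ = ∫⁻ y, ∫⁻ z, B.indicator (fun p => F p.1) (y, z) ∂μ.map Z ∂μ.map Y := by
        rw [← lintegral_map hG (hY.prodMk hZ), hYZ.map_prod_eq_prod_map_map
          hY.aemeasurable hZ.aemeasurable, lintegral_prod _ hG.aemeasurable]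
    _ ≤ ∫⁻ y, c * F y ∂μ.map Y := by
        refine lintegral_mono_ae (hc.mono fun y hy => ?_)
        have hBy : MeasurableSet {z | (y, z) ∈ B} := measurable_prodMk_left hB
        have : (fun z => B.indicator (fun p => F p.1) (y, z)) =
            {z | (y, z) ∈ B}.indicator fun _ => F y := rfl
        rw [this, lintegral_indicator_const hBy, mul_comm]
        gcongr
    _ = c * ∫⁻ s, F (Y s) ∂μ := by
        rw [lintegral_const_mul _ hF, lintegral_map hF hY]

end Independence

/-! ### Measurability of the closed loop -/

namespace ControlProblem

variable {Δ : Type*} [MeasurableSpace Δ] {n m N K R : ℕ}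

theorem Regular.measurable_step {C : ControlProblem Δ n m} (hC : C.Regular) :
    Measurable fun p : Δ × (Fin n → ℝ) × (Fin m → ℝ) => C.step p.1 p.2.1 p.2.2 := by
  refine measurable_pi_lambda _ fun i => ?_
  simp only [step, Pi.add_apply, Matrix.mulVec, dotProduct]
  refine ((Finset.measurable_sum _ fun j _ => ?_).add
    (Finset.measurable_sum _ fun j _ => ?_)).add ?_
  · exact ((hC.measurable_A i j).comp measurable_fst).mul
      ((measurable_pi_apply j).comp (measurable_fst.comp measurable_snd))
  · exact ((hC.measurable_B i j).comp measurable_fst).mul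
      ((measurable_pi_apply j).comp (measurable_snd.comp measurable_snd))
  · exact (measurable_pi_apply i).comp (hC.measurable_w.comp measurable_fst)

variable [NeZero N] {C : ControlProblem Δ n m} {𝒜 : RemovalAlgorithm Δ n N K R}
  {sol : (Fin n → ℝ) → Scenarios Δ K N → Plan m N}

theorem measurable_closedStep (hC : C.Regular) (hsol : C.IsScenarioSolution 𝒜 sol) :
    Measurable fun p : (Fin n → ℝ) × Δ × Scenarios Δ K N =>
      C.step p.2.1 p.1 (sol p.1 p.2.2 0) :=
  hC.measurable_step.comp ((measurable_fst.comp measurable_snd).prodMk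
    (measurable_fst.prodMk (hsol.measurable_first.comp
      (measurable_fst.prodMk (measurable_snd.comp measurable_snd)))))

/-- Only draws before `t` are assumed measurable, so the σ-algebra on `S` may be the one they
generate. -/
theorem measurable_closedLoop {S : Type*} [MeasurableSpace S] (hC : C.Regular)
    (hsol : C.IsScenarioSolution 𝒜 sol) {δ : ℕ → S → Δ} {ω : ℕ → S → Scenarios Δ K N} {t : ℕ}
    (hδ : ∀ r < t, Measurable (δ r)) (hω : ∀ r < t, Measurable (ω r)) :
    Measurable fun s => C.closedLoop sol (fun r => δ r s) (fun r => ω r s) t := by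
  induction t with
  | zero => exact measurable_const
  | succ t ih =>
    exact (measurable_closedStep hC hsol).comp
      ((ih (fun r hr => hδ r (hr.trans t.lt_succ_self))
        (fun r hr => hω r (hr.trans t.lt_succ_self))).prodMk
        ((hδ t t.lt_succ_self).prodMk (hω t t.lt_succ_self)))

end ControlProblem

/-! ### Laws and independence of the draws -/

namespace IsIID

variable {Δ S : Type*} [MeasurableSpace Δ] {mS : MeasurableSpace S} {K N : ℕ} {P : Measure Δ}
  {μ : Measure S} {δ : ℕ → S → Δ} {ω : ℕ → S → Scenarios Δ K N}

/-- All uncertainties and samples as one family. -/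
abbrev family (δ : ℕ → S → Δ) (ω : ℕ → S → Scenarios Δ K N) :
    ℕ ⊕ (ℕ × Fin K × Fin N) → S → Δ :=
  Sum.elim δ fun q s => ω q.1 s q.2.1 q.2.2

/-- The σ-algebra generated by the members of the family with index in `I`. -/
abbrev generated (δ : ℕ → S → Δ) (ω : ℕ → S → Scenarios Δ K N)
    (I : Set (ℕ ⊕ (ℕ × Fin K × Fin N))) : MeasurableSpace S :=
  ⨆ i ∈ I, MeasurableSpace.comap (family δ ω i) inferInstance

theorem measurable_generated {I : Set (ℕ ⊕ (ℕ × Fin K × Fin N))} {i} (hi : i ∈ I) :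
    Measurable[generated δ ω I] (family δ ω i) :=
  (comap_measurable _).mono (le_iSup₂_of_le i hi le_rfl) le_rfl

theorem measurable_generated_sample {I : Set (ℕ ⊕ (ℕ × Fin K × Fin N))} {t : ℕ}
    (hI : ∀ k i, Sum.inr (t, k, i) ∈ I) : Measurable[generated δ ω I] (ω t) :=
  @measurable_pi_lambda _ _ _ (generated δ ω I) _ _ fun k =>
    @measurable_pi_lambda _ _ _ (generated δ ω I) _ _ fun i =>
      measurable_generated (δ := δ) (ω := ω) (hI k i)

theorem measurable_sample' (h : IsIID P μ δ ω) (t : ℕ) : Measurable (ω t) :=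
  measurable_pi_lambda _ fun k => measurable_pi_lambda _ fun i => h.measurable_sample t k i

theorem indepFun_of_generated (h : IsIID P μ δ ω) {α β : Type*} [MeasurableSpace α]
    [MeasurableSpace β] {I J : Set (ℕ ⊕ (ℕ × Fin K × Fin N))} (hIJ : Disjoint I J)
    {Y : S → α} {Z : S → β} (hY : Measurable[generated δ ω I] Y)
    (hZ : Measurable[generated δ ω J] Z) : IndepFun Y Z μ := by
  have hle : ∀ i, MeasurableSpace.comap (family δ ω i) inferInstance ≤ mS := by
    rintro (t | ⟨t, k, i⟩)
    · exact (h.measurable_uncertainty t).comap_le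
    · exact (h.measurable_sample t k i).comap_le
  exact indep_of_indep_of_le_left
    (indep_of_indep_of_le_right (indep_iSup_of_disjoint hle h.indep hIJ) hZ.comap_le) hY.comap_le

/-- Independence gives a product law over pairs `(k, i)`; currying turns it into the iterated
product. -/
theorem map_sample_eq [IsProbabilityMeasure P] (h : IsIID P μ δ ω) (t : ℕ) :
    μ.map (ω t) = ControlProblem.scenarioLaw P K N := by
  have hinj : Function.Injective fun q : Fin K × Fin N =>
      (Sum.inr (t, q) : ℕ ⊕ (ℕ × Fin K × Fin N)) := fun a b hab => by simpa using hab
  have hm : Measurable fun s (q : Fin K × Fin N) => ω t s q.1 q.2 :=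
    measurable_pi_lambda _ fun q => h.measurable_sample t q.1 q.2
  have hlaw := (h.indep.precomp hinj).map_fun_eq_infinitePi_map₀ hm.aemeasurable
  simp only [h.map_sample] at hlaw
  have hcurry := Measure.infinitePi_map_curry (fun (_ : Fin K) (_ : Fin N) => P)
  rw [← hlaw, Measure.map_map (MeasurableEquiv.measurable _) hm] at hcurry
  rw [ControlProblem.scenarioLaw]
  simp only [← Measure.infinitePi_eq_pi]
  exact hcurry

theorem map_prod_eq [IsProbabilityMeasure P] [IsProbabilityMeasure μ] (h : IsIID P μ δ ω)
    (t : ℕ) :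
    μ.map (fun s => (δ t s, ω t s)) = P.prod (ControlProblem.scenarioLaw P K N) := by
  have hind : IndepFun (δ t) (ω t) μ :=
    h.indepFun_of_generated (I := Set.range Sum.inl) (J := Set.range Sum.inr)
      Set.isCompl_range_inl_range_inr.disjoint
      (measurable_generated (δ := δ) (ω := ω) (i := Sum.inl t) ⟨t, rfl⟩)
      (measurable_generated_sample fun k i => ⟨_, rfl⟩)
  rw [hind.map_prod_eq_prod_map_map (h.measurable_uncertainty t).aemeasurable
    (h.measurable_sample' t).aemeasurable, h.map_uncertainty, h.map_sample_eq]

/-- The indices of the variables drawn before time `t`. -/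
def past (K N t : ℕ) : Set (ℕ ⊕ (ℕ × Fin K × Fin N)) :=
  {i | Sum.elim id Prod.fst i < t}

theorem indepFun_past (h : IsIID P μ δ ω) {α : Type*} [MeasurableSpace α] {t : ℕ} {Y : S → α}
    (hY : Measurable[generated δ ω (past K N t)] Y) :
    IndepFun Y (fun s => (δ t s, ω t s)) μ := by
  refine h.indepFun_of_generated (disjoint_compl_right (a := past K N t)) hY ?_
  have hδ : Measurable[generated δ ω (past K N t)ᶜ] (δ t) :=
    measurable_generated (δ := δ) (ω := ω) (i := Sum.inl t) (lt_irrefl t)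
  have hω : Measurable[generated δ ω (past K N t)ᶜ] (ω t) :=
    measurable_generated_sample fun _ _ => lt_irrefl t
  exact Measurable.prodMk hδ hω

end IsIID

/-! ### Violation probability and feasibility at reached states -/

namespace ControlProblem

variable {Δ S : Type*} [MeasurableSpace Δ] {n m N K R : ℕ} [NeZero N]
  {P : Measure Δ} [IsProbabilityMeasure P]
  {C : ControlProblem Δ n m} {𝒜 : RemovalAlgorithm Δ n N K R}
  {sol : (Fin n → ℝ) → Scenarios Δ K N → Plan m N}

instance : IsProbabilityMeasure (scenarioLaw P K N) := by
  unfold scenarioLaw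
  infer_instance

theorem measurableSet_leavesStateSet (hC : C.Regular) (hsol : C.IsScenarioSolution 𝒜 sol) :
    MeasurableSet {p : (Fin n → ℝ) × Δ × Scenarios Δ K N |
      C.step p.2.1 p.1 (sol p.1 p.2.2 0) ∉ C.stateSet} :=
  measurable_closedStep hC hsol hC.measurableSet_stateSet.compl

theorem prod_leavesStateSet_eq (hC : C.Regular) (hsol : C.IsScenarioSolution 𝒜 sol)
    (x : Fin n → ℝ) :
    P.prod (scenarioLaw P K N) {z | C.step z.1 x (sol x z.2 0) ∉ C.stateSet} =
      ENNReal.ofReal (∫ ω, C.violationProb P sol x ω ∂scenarioLaw P K N) := by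
  have hB : MeasurableSet {z : Δ × Scenarios Δ K N | C.step z.1 x (sol x z.2 0) ∉ C.stateSet} :=
    measurable_prodMk_left (measurableSet_leavesStateSet hC hsol)
  have hV : Measurable fun ω : Scenarios Δ K N => P {d | C.step d x (sol x ω 0) ∉ C.stateSet} :=
    measurable_measure_prodMk_right hB
  have hint : ∫ ω, C.violationProb P sol x ω ∂scenarioLaw P K N =
      (∫⁻ ω, P {d | C.step d x (sol x ω 0) ∉ C.stateSet} ∂scenarioLaw P K N).toReal :=
    integral_toReal hV.aemeasurable (Eventually.of_forall fun ω => measure_lt_top _ _)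
  have hprod := Measure.prod_apply_symm (μ := P) (ν := scenarioLaw P K N) hB
  have hne := measure_ne_top (P.prod (scenarioLaw P K N))
    {z | C.step z.1 x (sol x z.2 0) ∉ C.stateSet}
  rw [hprod] at hne ⊢
  rw [hint]
  exact (ENNReal.ofReal_toReal hne).symm

theorem measurable_generated_closedLoop (hC : C.Regular) (hsol : C.IsScenarioSolution 𝒜 sol)
    (δ : ℕ → S → Δ) (ω : ℕ → S → Scenarios Δ K N) {r t : ℕ} (hrt : r ≤ t) :
    Measurable[IsIID.generated δ ω (IsIID.past K N t)]
      fun s => C.closedLoop sol (fun r => δ r s) (fun r => ω r s) r :=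
  @measurable_closedLoop _ _ _ _ _ _ _ _ _ _ _ _ (IsIID.generated δ ω (IsIID.past K N t))
    hC hsol δ ω r
    (fun q hq => IsIID.measurable_generated (δ := δ) (ω := ω) (i := Sum.inl q)
      (show q < t from hq.trans_le hrt))
    (fun q hq => IsIID.measurable_generated_sample fun _ _ => show q < t from hq.trans_le hrt)

/-- Resolvability makes almost every reached state one at which the admissibility bound holds. -/
theorem ae_map_feasible [MeasurableSpace S] {μ : Measure S} [IsProbabilityMeasure μ]
    {δ : ℕ → S → Δ} {ω : ℕ → S → Scenarios Δ K N} (hC : C.Regular)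
    (hsol : C.IsScenarioSolution 𝒜 sol)
    (hmeas : MeasurableSet {p : (Fin n → ℝ) × Scenarios Δ K N | ∃ u, C.IsFeasible 𝒜 p.1 p.2 u})
    (hiid : IsIID P μ δ ω) (hres : C.IsResolvable 𝒜 sol μ δ ω) (t : ℕ) :
    ∀ᵐ s ∂μ, ∀ᵐ z ∂scenarioLaw P K N, ∃ u,
      C.IsFeasible 𝒜 (C.closedLoop sol (fun r => δ r s) (fun r => ω r s) t) z u := by
  have hx : Measurable fun s => C.closedLoop sol (fun r => δ r s) (fun r => ω r s) t :=
    measurable_closedLoop hC hsol (fun r _ => hiid.measurable_uncertainty r)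
      (fun r _ => hiid.measurable_sample' r)
  have hω := hiid.measurable_sample' t
  have hind : IndepFun (fun s => C.closedLoop sol (fun r => δ r s) (fun r => ω r s) t) (ω t) μ :=
    (hiid.indepFun_past (measurable_generated_closedLoop hC hsol δ ω le_rfl)).comp
      measurable_id measurable_snd
  have hlaw := hind.map_prod_eq_prod_map_map hx.aemeasurable hω.aemeasurable
  -- State and scenarios have a product joint law, so almost sure feasibility of the pair splits by
  -- Fubini.
  have hjoint := (ae_map_iff (hx.prodMk hω).aemeasurable hmeas).2 (hres t)
  rw [hlaw, hiid.map_sample_eq] at hjoint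
  exact ae_of_ae_map hx.aemeasurable (Measure.ae_ae_of_ae_prod hjoint)

end ControlProblem

end SCMPC

theorem mainTheorem2 {Δ S : Type*} [MeasurableSpace Δ] [MeasurableSpace S]
    {n m N K R : ℕ} [NeZero N]
    (P : Measure Δ) [IsProbabilityMeasure P] (μ : Measure S) [IsProbabilityMeasure μ]
    (C : SCMPC.ControlProblem Δ n m) (hC : C.Regular)
    (𝒜 : SCMPC.RemovalAlgorithm Δ n N K R)
    (sol : (Fin n → ℝ) → SCMPC.Scenarios Δ K N → SCMPC.Plan m N)
    (hsol : C.IsScenarioSolution 𝒜 sol)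
    (hmeas : MeasurableSet
      {p : (Fin n → ℝ) × SCMPC.Scenarios Δ K N | ∃ u, C.IsFeasible 𝒜 p.1 p.2 u})
    (δ : ℕ → S → Δ) (ω : ℕ → S → SCMPC.Scenarios Δ K N)
    (hiid : SCMPC.IsIID P μ δ ω)
    (hres : C.IsResolvable 𝒜 sol μ δ ω)
    (ε : ℝ) (hε : ε ∈ Set.Ioo (0 : ℝ) (1 / 2))
    (hadm : C.IsAdmissible P 𝒜 sol ε) :
    ∀ᵐ s ∂μ, limsup (fun T : ℕ => (1 / (T : ℝ)) *
      ∑ t ∈ Finset.range T, C.violation sol (fun r => δ r s) (fun r => ω r s) t) atTop ≤ ε := by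
  let x : ℕ → S → Fin n → ℝ := fun t s => C.closedLoop sol (fun r => δ r s) (fun r => ω r s) t
  let A : ℕ → Set S := fun t => x (t + 1) ⁻¹' C.stateSetᶜ
  have hx : ∀ t, Measurable (x t) := fun t => SCMPC.ControlProblem.measurable_closedLoop hC hsol
    (fun r _ => hiid.measurable_uncertainty r) (fun r _ => hiid.measurable_sample' r)
  have hA : ∀ t, MeasurableSet (A t) := fun t => hx (t + 1) hC.measurableSet_stateSet.compl
  refine SCMPC.ae_limsup_eventCount_le hA hε.1.le (by linarith [hε.2]) fun l _ t => ?_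
  have hZ : Measurable fun s => (δ t s, ω t s) :=
    (hiid.measurable_uncertainty t).prodMk (hiid.measurable_sample' t)
  -- The count is carried with the state so that the exponential weight and the conditional bound
  -- depend on one past variable.
  let Y : S → (Fin n → ℝ) × ℝ := fun s => (x t s, SCMPC.eventCount A t s)
  have hY : Measurable Y :=
    (hx t).prodMk (SCMPC.measurable_eventCount fun r _ => hA r)
  have hxpast : ∀ r ≤ t, Measurable[SCMPC.IsIID.generated δ ω (SCMPC.IsIID.past K N t)] (x r) :=
    fun r hr => SCMPC.ControlProblem.measurable_generated_closedLoop hC hsol δ ω hr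
  have hcount : Measurable[SCMPC.IsIID.generated δ ω (SCMPC.IsIID.past K N t)]
      (SCMPC.eventCount A t) :=
    @SCMPC.measurable_eventCount _ (SCMPC.IsIID.generated δ ω (SCMPC.IsIID.past K N t)) A t
      -- Event `r` concerns `x (r + 1)`, and `r < t` is `r + 1 ≤ t`: the count up to `t` uses only
      -- past draws.
      fun r hr => hxpast (r + 1) hr hC.measurableSet_stateSet.compl
  have hYpast : Measurable[SCMPC.IsIID.generated δ ω (SCMPC.IsIID.past K N t)] Y :=
    Measurable.prodMk (hxpast t le_rfl) hcount
  have hBx := SCMPC.ControlProblem.measurableSet_leavesStateSet hC hsol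
  have hB : MeasurableSet {p : ((Fin n → ℝ) × ℝ) × Δ × SCMPC.Scenarios Δ K N |
      C.step p.2.1 p.1.1 (sol p.1.1 p.2.2 0) ∉ C.stateSet} :=
    ((measurable_fst.comp measurable_fst).prodMk measurable_snd) hBx
  have hbound : ∀ᵐ y ∂μ.map Y, μ.map (fun s => (δ t s, ω t s))
      {z | C.step z.1 y.1 (sol y.1 z.2 0) ∉ C.stateSet} ≤ ENNReal.ofReal ε := by
    rw [hiid.map_prod_eq t]
    refine (ae_map_iff hY.aemeasurable (measurableSet_le
      (measurable_measure_prodMk_left hB) measurable_const)).2 ?_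
    filter_upwards [SCMPC.ControlProblem.ae_map_feasible hC hsol hmeas hiid hres t] with s hs
    exact (SCMPC.ControlProblem.prod_leavesStateSet_eq hC hsol (x t s)).trans_le
      (ENNReal.ofReal_le_ofReal (hadm _ hs))
  exact SCMPC.setLIntegral_comp_le_of_indepFun hY hZ (hiid.indepFun_past hYpast) hB hbound
    (F := fun y => ENNReal.ofReal (Real.exp (l * y.2)))
    (measurable_snd.const_mul l).exp.ennreal_ofReal
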